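/- Let $p \ge 1$ and $0 < \varepsilon \le 1$ be real, and put $q = p/2$. Let $A \in \mathbb{R}^{n\times n}$ be symmetric positive definite with eigenvalues $\lambda_1,\dots,\lambda_n$ (counted with multiplicity), and let $\|A\|_p = \big(\sum_{j=1}^n \lambda_j^p\big)^{1/p}$ be its Schatten $p$-norm (for symmetric positive definite $A$ the singular values are the eigenvalues). Let $0 < a < b$ and let $[c,d] \subseteq [a,b]$, $c < d$, be an interval that contains all the eigenvalues of $A$ (for example $[c,d] = [a,b]$, or $[c,d] = [\lambda_{\min},\lambda_{\max}]$ if $\lambda_{\min} < \lambda_{\max}$). For an integer $N \ge 0$ let $\psi_N$ be the degree-$N$ Chebyshev approximation (truncated Chebyshev series) of $x \mapsto x^{p/2}$ on $[c,d]$, that is, $$\psi_N(x) = \sum_{j=0}^N \gamma_j\, T_j\!\left(\frac{2}{d-c}\,x - \frac{d+c}{d-c}\right), \qquad \gamma_j = \frac{2-\delta_{j0}}{\pi}\int_0^\pi \left(\frac{d-c}{2}\cos\theta + \frac{d+c}{2}\right)^{p/2}\cos(j\theta)\,d\theta,$$ where $T_j$ is the $j$-th Chebyshev polynomial of the first kind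 and $\delta_{j0}$ is $1$ for $j = 0$ and $0$ otherwise. Put $\kappa = \sqrt{b/a}$. If $$N \ \ge\ \frac{\log\left(\frac{4}{\varepsilon}(\kappa^2+1)^q(\kappa-1)\left(\kappa^p + \sqrt{\tfrac{\varepsilon}{2}+\kappa^{2p}}\right)\right)}{\log\left(\frac{\kappa+1}{\kappa-1}\right)},$$ then $$\left|\operatorname{tr}\big(\psi_N(A)^2\big) - \|A\|_p^p\right| \ \le\ \frac{\varepsilon}{2}\,\|A\|_p^p .$$ -/

import Mathlib

/-- The `j`-th Chebyshev coefficient of `g` on the interval `[c, d]`: the coefficient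
`(2 / π) ∫ θ in 0..π, h (cos θ) cos (j θ)`, with an additional factor of a half when `j = 0`, of
the function `h (t) = g ((d - c) / 2 * t + (d + c) / 2)` obtained by transplanting `g` from
`[c, d]` to `[-1, 1]`. -/
noncomputable def chebyshevCoeff (c d : ℝ) (g : ℝ → ℝ) (j : ℕ) : ℝ :=
  (if j = 0 then 1 / Real.pi else 2 / Real.pi) *
    ∫ θ in (0 : ℝ)..Real.pi,
      g ((d - c) / 2 * Real.cos θ + (d + c) / 2) * Real.cos ((j : ℝ) * θ)

/-- The degree-`N` Chebyshev approximation (truncated Chebyshev series) of `g` on the interval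
`[c, d]`, as a polynomial: `∑ j ≤ N, c_j T_j (2 / (d - c) * x - (d + c) / (d - c))`. -/
noncomputable def chebyshevApprox (c d : ℝ) (g : ℝ → ℝ) (N : ℕ) : Polynomial ℝ :=
  ∑ j ∈ Finset.range (N + 1),
    Polynomial.C (chebyshevCoeff c d g j) *
      (Polynomial.Chebyshev.T ℝ (j : ℤ)).comp
        (Polynomial.C (2 / (d - c)) * Polynomial.X - Polynomial.C ((d + c) / (d - c)))

/-- The Schatten `p`-norm `(∑ j, σ_j ^ p) ^ (1 / p)` of a real `m × n` matrix, the sum being over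
its `min m n` leading singular values `σ_j`. -/
noncomputable def schattenNorm {m n : ℕ} (p : ℝ) (A : Matrix (Fin m) (Fin n) ℝ) : ℝ :=
  (∑ j ∈ Finset.range (min m n), (Matrix.toEuclideanLin A).singularValues j ^ p) ^ (1 / p)

/-! Both the trace and the Schatten norm are sums over the eigenvalues of `A`, so a relative error
bound for `ψ_N(x) ^ 2` against `x ^ p` on `[c, d]` suffices. With `x = (d - c) / 2 * cos θ + (d + c)
/ 2` the Chebyshev series becomes a Fourier cosine series. On `|z| = 1` the right side is `w(z) = (d
- c) / 4 * (z + z⁻¹) + (d + c) / 2`, and `w ^ q` is holomorphic as long as `w` has positive real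
part. Since `d ≤ κ² c`, this holds for `1 ≤ |z| < ρ = (κ + 1) / (κ - 1)`, where also `|w| ≤ c (κ² +
1)`. Shifting the contour (`norm_integral_circleMap_le`) makes the coefficients decay like `ρ⁻ʲ`,
and summing the tail gives `abs_eval_chebyshevApprox_rpow_sub_le`. As `x ^ q ≥ c ^ q`, the relative
error is at most `δ = (κ² + 1) ^ q (κ - 1) ρ⁻ᴺ ≤ ε / 8`; squaring turns it into `2 δ + δ² ≤ ε / 2`.
-/

/-! ### Spectral sums -/

theorem Matrix.IsHermitian.charpoly_aeval {n : ℕ} {A : Matrix (Fin n) (Fin n) ℝ}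
    (hA : A.IsHermitian) (P : Polynomial ℝ) :
    (Polynomial.aeval A P).charpoly =
      ∏ i, (Polynomial.X - Polynomial.C (P.eval (hA.eigenvalues i))) := by
  have h : Polynomial.aeval A P =
      Unitary.conjStarAlgAut ℝ _ hA.eigenvectorUnitary
        (Matrix.diagonal fun i => P.eval (hA.eigenvalues i)) := by
    conv_lhs => rw [hA.spectral_theorem]
    refine (Polynomial.aeval_algHom_apply (Unitary.conjStarAlgAut ℝ (Matrix (Fin n) (Fin n) ℝ)
      hA.eigenvectorUnitary) (Matrix.diagonal (RCLike.ofReal ∘ hA.eigenvalues)) P).trans ?_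
    have h2 := Polynomial.aeval_algHom_apply (Matrix.diagonalAlgHom (n := Fin n) (α := ℝ) ℝ)
      (hA.eigenvalues) P
    have h3 : Matrix.diagonal (RCLike.ofReal ∘ hA.eigenvalues) =
      Matrix.diagonalAlgHom (n := Fin n) (α := ℝ) ℝ hA.eigenvalues := rfl
    rw [h3, h2]
    change _ = (Unitary.conjStarAlgAut ℝ (Matrix (Fin n) (Fin n) ℝ) hA.eigenvectorUnitary)
      (Matrix.diagonalAlgHom (n := Fin n) (α := ℝ) ℝ fun i => P.eval (hA.eigenvalues i))
    congr 2
    ext i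
    simp
  rw [h, Unitary.conjStarAlgAut_apply, Matrix.charpoly_mul_comm, ← mul_assoc]
  simp [Matrix.charpoly_diagonal]

theorem Matrix.IsHermitian.trace_aeval {n : ℕ} {A : Matrix (Fin n) (Fin n) ℝ}
    (hA : A.IsHermitian) (P : Polynomial ℝ) :
    (Polynomial.aeval A P).trace = ∑ i, P.eval (hA.eigenvalues i) := by
  have hs : (Polynomial.aeval A P).charpoly.Splits := by
    rw [hA.charpoly_aeval]
    exact Polynomial.Splits.prod fun i _ => Polynomial.Splits.X_sub_C _
  rw [Matrix.trace_eq_sum_roots_charpoly_of_splits hs, hA.charpoly_aeval, Polynomial.roots_prod _ _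
    (by simp [Finset.prod_ne_zero_iff, Polynomial.X_sub_C_ne_zero])]
  simp [List.sum_ofFn]

/-- Singular values are square roots of the roots of the characteristic polynomial of `A ^ 2`.
Comparing root multisets avoids matching two orderings of the spectrum. -/
theorem Matrix.PosSemidef.sum_singularValues {n : ℕ} {A : Matrix (Fin n) (Fin n) ℝ}
    (hA : A.PosSemidef) (f : ℝ → ℝ) :
    ∑ j ∈ Finset.range n, f ((Matrix.toEuclideanLin A).singularValues j) =
      ∑ i, f (hA.isHermitian.eigenvalues i) := by
  set T := Matrix.toEuclideanLin A with hT
  have hn : Module.finrank ℝ (EuclideanSpace ℝ (Fin n)) = n := by simp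
  have hadj : LinearMap.adjoint T = T := by
    rw [hT, ← Matrix.toEuclideanLin_conjTranspose_eq_adjoint, hA.isHermitian.eq]
  have hcp : (LinearMap.adjoint T ∘ₗ T).charpoly =
      (Polynomial.aeval A (Polynomial.X ^ 2 : Polynomial ℝ)).charpoly := by
    rw [hadj, map_pow, Polynomial.aeval_X, sq]
    have hTT : T ∘ₗ T = Matrix.toEuclideanLin (A * A) := by
      rw [hT, Matrix.toLpLin_mul_same]
    rw [hTT, Matrix.toEuclideanLin_eq_toLin_orthonormal, Matrix.charpoly_toLin]
  have hr := T.isSymmetric_adjoint_comp_self.roots_charpoly_eq_eigenvalues hn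
  rw [hcp, hA.isHermitian.charpoly_aeval, Polynomial.roots_prod _ _
    (Finset.prod_ne_zero_iff.2 fun i _ => Polynomial.X_sub_C_ne_zero _)] at hr
  have hs := congrArg (fun s : Multiset ℝ => (s.map fun x => f (√x)).sum) hr
  simp only [Polynomial.roots_X_sub_C, Multiset.bind_singleton, Multiset.map_map] at hs
  rw [Finset.sum_range]
  simp only [T.singularValues_fin hn]
  refine Eq.trans ?_ (hs.symm.trans ?_)
  · simp [Finset.sum]
  · change ∑ i, _ = _
    refine Finset.sum_congr rfl fun i _ => ?_
    simp [Real.sqrt_sq (hA.eigenvalues_nonneg i)]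

/-! ### Laurent and Fourier coefficients -/

open Complex in
/-- Cauchy estimate for the Laurent coefficients of a function holomorphic on an annulus. -/
theorem norm_integral_circleMap_le {F : ℂ → ℂ} {R M : ℝ} (hR : 1 ≤ R)
    (hF : ∀ z : ℂ, 1 ≤ ‖z‖ → ‖z‖ ≤ R → DifferentiableAt ℂ F z)
    (hM : ∀ z : ℂ, ‖z‖ = R → ‖F z‖ ≤ M) (n : ℕ) :
    ‖∫ θ in (0 : ℝ)..2 * Real.pi, F (circleMap 0 1 θ) * (circleMap 0 1 θ ^ n)⁻¹‖ ≤
      2 * Real.pi * M * (R ^ n)⁻¹ := by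
  have hR0 : 0 < R := by linarith
  have hd : ∀ z : ℂ, 1 ≤ ‖z‖ → ‖z‖ ≤ R → DifferentiableAt ℂ (fun z => F z * (z ^ n)⁻¹) z := by
    intro z h1 h2
    have hz : z ≠ 0 := norm_pos_iff.1 (by linarith)
    exact (hF z h1 h2).mul ((differentiableAt_id.pow n).inv (pow_ne_zero _ hz))
  -- The integral of `F z * z⁻ⁿ` against `dz / z = i dθ` is the same over both boundary circles.
  have key := circleIntegral_sub_center_inv_smul_eq_of_differentiable_on_annulus_off_countable
    (c := 0) (r := 1) (R := R) one_pos hR (f := fun z => F z * (z ^ n)⁻¹) Set.countable_empty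
    (fun z hz => (hd z (by simpa using hz.2) (by simpa using hz.1)).continuousAt.continuousWithinAt)
    (fun z hz => hd z (by simpa using (not_le.1 fun h => hz.1.2 (by simpa using h)).le)
      (by simpa using (Metric.ball_subset_closedBall hz.1.1)))
  have h1 : (∮ z in C(0, 1), (z - 0)⁻¹ • (F z * (z ^ n)⁻¹)) =
      I * ∫ θ in (0 : ℝ)..2 * Real.pi, F (circleMap 0 1 θ) * (circleMap 0 1 θ ^ n)⁻¹ := by
    rw [circleIntegral, ← intervalIntegral.integral_const_mul]
    refine intervalIntegral.integral_congr fun θ _ => ?_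
    have := circleMap_ne_center (c := 0) (R := 1) one_ne_zero (θ := θ)
    simp only [deriv_circleMap, smul_eq_mul, sub_zero]
    field_simp
  have h2 : ‖∮ z in C(0, R), (z - 0)⁻¹ • (F z * (z ^ n)⁻¹)‖ ≤
      2 * Real.pi * R * (R⁻¹ * (M * (R ^ n)⁻¹)) := by
    refine circleIntegral.norm_integral_le_of_norm_le_const hR0.le fun z hz => ?_
    have hz : ‖z‖ = R := by simpa using hz
    rw [sub_zero, norm_smul, norm_mul, norm_inv, norm_inv, norm_pow, hz]
    gcongr
    exact hM z hz
  rw [key, h1, norm_mul, norm_I, one_mul] at h2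
  refine h2.trans_eq ?_
  field_simp

/-- The Fourier coefficients of an even function are its cosine coefficients. -/
theorem integral_mul_exp_of_even {G : ℝ → ℝ} (hG : Continuous G)
    (hsymm : ∀ θ, G (2 * Real.pi - θ) = G θ) (n : ℤ) :
    ∫ θ in (0 : ℝ)..2 * Real.pi, (G θ : ℂ) * Complex.exp (-(n * θ * Complex.I)) =
      ((2 * ∫ θ in (0 : ℝ)..Real.pi, G θ * Real.cos (n * θ) : ℝ) : ℂ) := by
  have hper1 (θ : ℝ) : Real.cos (n * (2 * Real.pi - θ)) = Real.cos (n * θ) := by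
    rw [mul_sub, Real.cos_int_mul_two_pi_sub]
  have hper2 (θ : ℝ) : Real.sin (n * (2 * Real.pi - θ)) = -Real.sin (n * θ) := by
    rw [mul_sub, Real.sin_int_mul_two_pi_sub]
  have hs : ∫ θ in (0 : ℝ)..2 * Real.pi, G θ * Real.sin (n * θ) = 0 := by
    have := intervalIntegral.integral_comp_sub_left (a := 0) (b := 2 * Real.pi)
      (fun θ => G θ * Real.sin (n * θ)) (2 * Real.pi)
    simp only [hsymm, hper2, mul_neg, intervalIntegral.integral_neg, sub_self, sub_zero] at this
    linarith
  have hc : ∫ θ in (0 : ℝ)..2 * Real.pi, G θ * Real.cos (n * θ) =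
      2 * ∫ θ in (0 : ℝ)..Real.pi, G θ * Real.cos (n * θ) := by
    have := intervalIntegral.integral_comp_sub_left (a := 0) (b := Real.pi)
      (fun θ => G θ * Real.cos (n * θ)) (2 * Real.pi)
    simp only [hsymm, hper1, sub_zero] at this
    have hi (a b : ℝ) : IntervalIntegrable (fun θ => G θ * Real.cos (n * θ))
        MeasureTheory.volume a b := (by fun_prop : Continuous _).intervalIntegrable _ _
    rw [← intervalIntegral.integral_add_adjacent_intervals (hi 0 Real.pi) (hi Real.pi _), this]
    ring_nf
  have hi1 : IntervalIntegrable (fun θ => ((G θ * Real.cos (n * θ) : ℝ) : ℂ))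
      MeasureTheory.volume 0 (2 * Real.pi) := (by fun_prop : Continuous _).intervalIntegrable _ _
  have hi2 : IntervalIntegrable (fun θ => ((G θ * Real.sin (n * θ) : ℝ) : ℂ) * Complex.I)
      MeasureTheory.volume 0 (2 * Real.pi) := (by fun_prop : Continuous _).intervalIntegrable _ _
  have he (θ : ℝ) : (G θ : ℂ) * Complex.exp (-(n * θ * Complex.I)) =
      ((G θ * Real.cos (n * θ) : ℝ) : ℂ) - ((G θ * Real.sin (n * θ) : ℝ) : ℂ) * Complex.I := by
    rw [← neg_mul, Complex.exp_mul_I, Complex.cos_neg, Complex.sin_neg]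
    push_cast; ring
  simp only [he]
  rw [intervalIntegral.integral_sub hi1 hi2, intervalIntegral.integral_mul_const,
    intervalIntegral.integral_ofReal, intervalIntegral.integral_ofReal, hs, hc]
  simp

/-- The cosine series of a continuous even `2π`-periodic function with geometrically decaying
coefficients converges pointwise to the function. -/
theorem hasSum_cosineSeries {G : ℝ → ℝ} (hG : Continuous G)
    (hper : Function.Periodic G (2 * Real.pi)) (hsymm : ∀ θ, G (2 * Real.pi - θ) = G θ)
    {u : ℕ → ℝ} (hu : Summable u)
    (ha : ∀ j : ℕ, |∫ θ in (0 : ℝ)..Real.pi, G θ * Real.cos (j * θ)| ≤ u j) (θ : ℝ) :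
    HasSum (fun j : ℕ => ((if j = 0 then 1 / Real.pi else 2 / Real.pi) *
      ∫ t in (0 : ℝ)..Real.pi, G t * Real.cos (j * t)) * Real.cos (j * θ)) (G θ) := by
  have : Fact (0 < 2 * Real.pi) := ⟨Real.two_pi_pos⟩
  set a : ℤ → ℝ := fun n => ∫ t in (0 : ℝ)..Real.pi, G t * Real.cos (n * t) with ha_def
  have hperC : Function.Periodic (fun t => (G t : ℂ)) (2 * Real.pi) := fun t => by simp [hper t]
  let f : C(AddCircle (2 * Real.pi), ℂ) :=
    ⟨hperC.lift, continuous_coinduced_dom.2 (Complex.continuous_ofReal.comp hG)⟩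
  have hf (t : ℝ) : f (t : AddCircle (2 * Real.pi)) = G t := hperC.lift_coe t
  have hexp (n : ℤ) (t : ℝ) : fourier n (t : AddCircle (2 * Real.pi)) =
      Complex.exp (n * t * Complex.I) := by
    rw [fourier_coe_apply]
    congr 1
    have : (Real.pi : ℂ) ≠ 0 := by exact_mod_cast Real.pi_ne_zero
    push_cast
    field_simp
  have hcoef (n : ℤ) : fourierCoeff f n = ((a n / Real.pi : ℝ) : ℂ) := by
    rw [fourierCoeff_eq_intervalIntegral _ _ 0, zero_add]
    have : (fun x : ℝ => fourier (-n) (x : AddCircle (2 * Real.pi)) •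
        f (x : AddCircle (2 * Real.pi))) =
        fun x : ℝ => (G x : ℂ) * Complex.exp (-(n * x * Complex.I)) := by
      funext x
      rw [hexp, hf, smul_eq_mul, mul_comm]
      push_cast; ring_nf
    rw [this, integral_mul_exp_of_even hG hsymm]
    rw [Complex.real_smul, ← Complex.ofReal_mul]
    congr 1
    field_simp
    simp [ha_def]
  have haneg (n : ℤ) : a (-n) = a n := by simp [ha_def]
  have habs (n : ℕ) : |a n| ≤ u n := by simpa [ha_def] using ha n
  have hsum : Summable (fourierCoeff f) := by
    simp only [funext hcoef]
    rw [Complex.summable_ofReal]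
    refine Summable.div_const ?_ _
    have : Summable fun n : ℕ => a n :=
      Summable.of_norm_bounded hu fun n => by simpa using habs n
    exact Summable.of_nat_of_neg this (by simpa [haneg] using this)
  have h1 := (has_pointwise_sum_fourier_series_of_summable hsum (θ : AddCircle _)).nat_add_neg
  simp only [hcoef, hexp, hf, haneg] at h1
  have h2 := Complex.hasSum_re h1
  -- Pairing `n` with `-n` counts the zero mode twice; removing one copy produces the halved
  -- coefficient at `j = 0`.
  have h3 := (hasSum_ite_eq (0 : ℕ) (a 0 / Real.pi))
  have h4 := h2.sub h3
  convert h4 using 1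
  · rfl
  · funext j
    have hre (x : ℝ) (n : ℤ) : (((x : ℝ) : ℂ) • Complex.exp (n * θ * Complex.I)).re =
        x * Real.cos (n * θ) := by
      rw [smul_eq_mul, Complex.re_ofReal_mul, ← Complex.ofReal_intCast, ← Complex.ofReal_mul,
        Complex.exp_ofReal_mul_I_re]
    rw [Complex.add_re, hre, hre]
    rcases eq_or_ne j 0 with rfl | hj
    · simp [ha_def]; ring
    · simp [hj, ha_def]; ring
  · simp

/-! ### Chebyshev truncation error for real powers -/

theorem norm_add_inv_le {z : ℂ} {R : ℝ} (h1 : 1 ≤ ‖z‖) (h2 : ‖z‖ ≤ R) :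
    ‖z + z⁻¹‖ ≤ R + R⁻¹ := by
  refine (norm_add_le _ _).trans ?_
  rw [norm_inv]
  have hz : 0 < ‖z‖ := by linarith
  have hR : 0 < R := by linarith
  rw [← sub_nonneg]
  have : R + R⁻¹ - (‖z‖ + ‖z‖⁻¹) = (R - ‖z‖) * (R * ‖z‖ - 1) / (R * ‖z‖) := by
    field_simp; ring
  rw [this]
  have : 1 ≤ R * ‖z‖ := one_le_mul_of_one_le_of_one_le (h1.trans h2) h1
  exact div_nonneg (mul_nonneg (by linarith) (by linarith)) (by positivity)

/-- Decay of the Chebyshev coefficients of `x ↦ x ^ q` from holomorphy on a Bernstein ellipse. -/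
theorem abs_integral_rpow_mul_cos_le_of_lt {c d q R : ℝ} (hcd : c < d) (hq : 0 ≤ q)
    (hR : 1 ≤ R) (hRlt : (d - c) / 4 * (R + R⁻¹) < (d + c) / 2) (n : ℕ) :
    |∫ θ in (0 : ℝ)..Real.pi, ((d - c) / 2 * Real.cos θ + (d + c) / 2) ^ q * Real.cos (n * θ)| ≤
      Real.pi * ((d - c) / 4 * (R + R⁻¹) + (d + c) / 2) ^ q * (R ^ n)⁻¹ := by
  set α : ℝ := (d - c) / 4 with hα
  set β : ℝ := (d + c) / 2 with hβ
  have hα0 : 0 < α := by rw [hα]; linarith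
  set w : ℂ → ℂ := fun z => α * (z + z⁻¹) + β with hw
  have hre (z : ℂ) (h1 : 1 ≤ ‖z‖) (h2 : ‖z‖ ≤ R) : 0 < (w z).re := by
    have h3 := neg_le_of_abs_le ((Complex.abs_re_le_norm _).trans (norm_add_inv_le h1 h2))
    have h4 : (w z).re = α * (z + z⁻¹).re + β := by
      simp only [hw, Complex.add_re, Complex.re_ofReal_mul, Complex.ofReal_re]
    rw [h4]
    nlinarith
  have hcm (θ : ℝ) : w (circleMap 0 1 θ) = (((d - c) / 2 * Real.cos θ + β : ℝ) : ℂ) := by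
    simp only [hw, circleMap, zero_add, Complex.ofReal_one, one_mul, ← Complex.exp_neg, hα]
    push_cast [Complex.cos]
    ring_nf
  have hpos (θ : ℝ) : 0 < (d - c) / 2 * Real.cos θ + β := by
    have := hre (circleMap 0 1 θ) (by simp) (by simpa using hR)
    rwa [hcm, Complex.ofReal_re] at this
  have h := norm_integral_circleMap_le (F := fun z => w z ^ (q : ℂ)) (R := R)
    (M := (α * (R + R⁻¹) + β) ^ q) hR ?_ ?_ n
  · have hG : Continuous fun θ => ((d - c) / 2 * Real.cos θ + β) ^ q :=
      (by fun_prop : Continuous fun θ => (d - c) / 2 * Real.cos θ + β).rpow_const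
        fun θ => Or.inl (hpos θ).ne'
    have he := integral_mul_exp_of_even hG (fun θ => by rw [Real.cos_two_pi_sub]) n
    have heq : ∫ θ in (0 : ℝ)..2 * Real.pi,
        w (circleMap 0 1 θ) ^ (q : ℂ) * (circleMap 0 1 θ ^ n)⁻¹ =
        ∫ θ in (0 : ℝ)..2 * Real.pi, ((((d - c) / 2 * Real.cos θ + β) ^ q : ℝ) : ℂ) *
          Complex.exp (-(((n : ℤ) : ℂ) * θ * Complex.I)) := by
      refine intervalIntegral.integral_congr fun θ _ => ?_
      rw [hcm, Complex.ofReal_cpow (hpos θ).le, circleMap, zero_add, Complex.ofReal_one, one_mul,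
        ← Complex.exp_nat_mul, ← Complex.exp_neg, mul_assoc, Int.cast_natCast]
    rw [heq, he, Complex.norm_real, Real.norm_eq_abs, abs_mul, abs_two] at h
    simp only [Int.cast_natCast] at h
    linarith
  · intro z h1 h2
    have hz : z ≠ 0 := norm_pos_iff.1 (by linarith)
    refine DifferentiableAt.cpow_const ?_ (Or.inl (hre z h1 h2))
    exact ((differentiableAt_id.add (differentiableAt_inv hz)).const_mul _).add_const _
  · intro z hz
    have h0 : w z ≠ 0 := fun h0 => by
      have := hre z (by rw [hz]; exact hR) hz.le
      simp [h0] at this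
    have hwn : ‖w z‖ ≤ α * (R + R⁻¹) + β := by
      refine (norm_add_le _ _).trans ?_
      have hβ0 : 0 < β := lt_trans (by positivity) hRlt
      rw [norm_mul, Complex.norm_real, Complex.norm_real, Real.norm_of_nonneg hα0.le,
        Real.norm_of_nonneg hβ0.le]
      gcongr
      exact norm_add_inv_le (by rw [hz]; exact hR) hz.le
    change ‖w z ^ (q : ℂ)‖ ≤ _
    rw [Complex.norm_cpow_real]
    exact Real.rpow_le_rpow (norm_nonneg _) hwn hq

/-- The radius `ρ = (κ + 1) / (κ - 1)` is critical: if `d = κ² c`, its ellipse passes through the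
branch point `0` and has rightmost point `c (κ² + 1)`. -/
theorem abs_integral_rpow_mul_cos_le {c d q κ : ℝ} (hc : 0 < c) (hcd : c < d) (hq : 0 ≤ q)
    (hκ : 1 < κ) (hdκ : d ≤ κ ^ 2 * c) (n : ℕ) :
    |∫ θ in (0 : ℝ)..Real.pi, ((d - c) / 2 * Real.cos θ + (d + c) / 2) ^ q * Real.cos (n * θ)| ≤
      Real.pi * (c * (κ ^ 2 + 1)) ^ q * (((κ + 1) / (κ - 1)) ^ n)⁻¹ := by
  set ρ := (κ + 1) / (κ - 1) with hρ
  have hκ1 : 0 < κ - 1 := by linarith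
  have hρ1 : 1 < ρ := by rw [hρ, one_lt_div hκ1]; linarith
  have hρinv : ρ + ρ⁻¹ = 2 * (κ ^ 2 + 1) / (κ ^ 2 - 1) := by
    have : κ ^ 2 - 1 ≠ 0 := by nlinarith
    have : κ + 1 ≠ 0 := by linarith
    rw [hρ, show κ ^ 2 - 1 = (κ + 1) * (κ - 1) by ring]
    field_simp
    ring
  have hκ2 : 0 < κ ^ 2 - 1 := by nlinarith
  have hle1 : (d - c) / 4 * (ρ + ρ⁻¹) ≤ (d + c) / 2 := by
    rw [hρinv, ← mul_div_assoc, div_le_iff₀ hκ2]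
    nlinarith
  have hle2 : (d - c) / 4 * (ρ + ρ⁻¹) + (d + c) / 2 ≤ c * (κ ^ 2 + 1) := by
    rw [hρinv, ← mul_div_assoc, ← le_sub_iff_add_le, div_le_iff₀ hκ2]
    nlinarith
  have hcont : ContinuousAt (fun R : ℝ => Real.pi * (c * (κ ^ 2 + 1)) ^ q * (R ^ n)⁻¹) ρ :=
    continuousAt_const.mul ((continuousAt_id.pow n).inv₀ (pow_ne_zero _ (by simp; linarith)))
  -- Holomorphy may fail at radius `ρ` itself, so the bound is proved for `R < ρ` and passed to the
  -- limit.
  refine ge_of_tendsto (hcont.tendsto.mono_left nhdsWithin_le_nhds : Filter.Tendsto _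
    (nhdsWithin ρ (Set.Iio ρ)) _) ?_
  filter_upwards [Ioo_mem_nhdsLT hρ1] with R hR
  have hR0 : 0 < R := by linarith [hR.1]
  have hlt : R + R⁻¹ < ρ + ρ⁻¹ := by
    rw [← sub_pos]
    have : ρ + ρ⁻¹ - (R + R⁻¹) = (ρ - R) * (ρ * R - 1) / (ρ * R) := by
      field_simp; ring
    rw [this]
    have : 1 < ρ * R := one_lt_mul_of_lt_of_le hρ1 hR.1.le
    exact div_pos (mul_pos (by linarith [hR.2]) (by linarith)) (by positivity)
  have hlt' : (d - c) / 4 * (R + R⁻¹) < (d - c) / 4 * (ρ + ρ⁻¹) :=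
    mul_lt_mul_of_pos_left hlt (by linarith)
  refine (abs_integral_rpow_mul_cos_le_of_lt hcd hq hR.1.le (hlt'.trans_le hle1) n).trans ?_
  have h0 : 0 ≤ (d - c) / 4 * (R + R⁻¹) := mul_nonneg (by linarith) (by positivity)
  gcongr
  · linarith
  · linarith

/-- Truncation error of the Chebyshev series of `x ↦ x ^ q`. -/
theorem abs_eval_chebyshevApprox_rpow_sub_le {c d q κ : ℝ} (hc : 0 < c) (hcd : c < d) (hq : 0 ≤ q)
    (hκ : 1 < κ) (hdκ : d ≤ κ ^ 2 * c) (N : ℕ) {x : ℝ} (hx : x ∈ Set.Icc c d) :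
    |(chebyshevApprox c d (fun x : ℝ => x ^ q) N).eval x - x ^ q| ≤
      (c * (κ ^ 2 + 1)) ^ q * (κ - 1) * (((κ + 1) / (κ - 1)) ^ N)⁻¹ := by
  have hκ1 : 0 < κ - 1 := by linarith
  have hdc : d - c ≠ 0 := by linarith
  set t : ℝ := 2 / (d - c) * x - (d + c) / (d - c) with ht
  set θ := Real.arccos t with hθ
  have ht' : t = (2 * x - (d + c)) / (d - c) := by rw [ht]; ring
  have hcos : Real.cos θ = t := by
    refine Real.cos_arccos ?_ ?_
    · rw [ht', le_div_iff₀ (sub_pos.2 hcd)]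
      linarith [hx.1]
    · rw [ht', div_le_one (sub_pos.2 hcd)]
      linarith [hx.2]
  have hxθ : (d - c) / 2 * Real.cos θ + (d + c) / 2 = x := by
    rw [hcos, ht]; field_simp; ring
  set r : ℝ := (κ - 1) / (κ + 1) with hr
  have hr0 : 0 ≤ r := by positivity
  have hr1 : r < 1 := by rw [hr, div_lt_one (by linarith)]; linarith
  have hinv (j : ℕ) : (((κ + 1) / (κ - 1)) ^ j)⁻¹ = r ^ j := by rw [← inv_pow, inv_div]
  set M := (c * (κ ^ 2 + 1)) ^ q with hM
  have hpos (s : ℝ) : 0 < (d - c) / 2 * Real.cos s + (d + c) / 2 := by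
    nlinarith [Real.neg_one_le_cos s]
  have hG : Continuous fun s => ((d - c) / 2 * Real.cos s + (d + c) / 2) ^ q :=
    (by fun_prop : Continuous fun s => (d - c) / 2 * Real.cos s + (d + c) / 2).rpow_const
      fun s => Or.inl (hpos s).ne'
  have hbd (j : ℕ) := abs_integral_rpow_mul_cos_le hc hcd hq hκ hdκ j
  simp only [hinv, ← hM] at hbd ⊢
  have hsum := hasSum_cosineSeries hG (fun s => by simp) (fun s => by rw [Real.cos_two_pi_sub])
    ((summable_geometric_of_lt_one hr0 hr1).mul_left (Real.pi * M)) hbd θ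
  rw [hxθ] at hsum
  have heval : (chebyshevApprox c d (fun x : ℝ => x ^ q) N).eval x =
      ∑ j ∈ Finset.range (N + 1), chebyshevCoeff c d (fun x : ℝ => x ^ q) j *
        Real.cos (j * θ) := by
    rw [chebyshevApprox, Polynomial.eval_finsetSum]
    refine Finset.sum_congr rfl fun j _ => ?_
    simp only [Polynomial.eval_mul, Polynomial.eval_C, Polynomial.eval_comp, Polynomial.eval_sub,
      Polynomial.eval_X, ← ht, ← hcos, Polynomial.Chebyshev.T_real_cos, Int.cast_natCast]
  have htail := (hasSum_nat_add_iff' (N + 1)).2 hsum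
  have hgeom := ((hasSum_geometric_of_lt_one hr0 hr1).mul_left (2 * M * r ^ (N + 1)))
  rw [heval, abs_sub_comm]
  change |x ^ q - ∑ j ∈ Finset.range (N + 1), ((if j = 0 then 1 / Real.pi else 2 / Real.pi) *
      ∫ t in (0 : ℝ)..Real.pi, ((d - c) / 2 * Real.cos t + (d + c) / 2) ^ q * Real.cos (j * t)) *
        Real.cos (j * θ)| ≤ _
  rw [← htail.tsum_eq, ← Real.norm_eq_abs]
  refine (tsum_of_norm_bounded hgeom fun j => ?_).trans_eq ?_
  · rw [if_neg (by omega), norm_mul, norm_mul, Real.norm_eq_abs, Real.norm_eq_abs,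
      Real.norm_eq_abs, abs_of_nonneg (by positivity : 0 ≤ 2 / Real.pi)]
    calc _ ≤ 2 / Real.pi * (Real.pi * M * r ^ (j + (N + 1))) * 1 := by
          gcongr
          · exact hbd _
          · exact Real.abs_cos_le_one _
      _ = 2 * M * r ^ (N + 1) * r ^ j := by field_simp; ring
  -- The geometric tail is `2 M r ^ (N + 1) / (1 - r)`, with `1 - r = 2 / (κ + 1)` and `r (κ + 1) =
  -- κ - 1`.
  · have : κ + 1 ≠ 0 := by linarith
    have h1r : 1 - r = 2 / (κ + 1) := by rw [hr]; field_simp; ring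
    have h2r : r = (κ - 1) / (κ + 1) := hr
    rw [h1r, pow_succ]
    nth_rw 2 [h2r]
    field_simp

/-! ### From relative error to the trace estimate -/

theorem Matrix.PosSemidef.schattenNorm_rpow {n : ℕ} {A : Matrix (Fin n) (Fin n) ℝ}
    (hA : A.PosSemidef) {p : ℝ} (hp : p ≠ 0) :
    schattenNorm p A ^ p = ∑ i, hA.isHermitian.eigenvalues i ^ p := by
  rw [schattenNorm, min_self, hA.sum_singularValues fun x => x ^ p, ← Real.rpow_mul
    (Finset.sum_nonneg fun i _ => Real.rpow_nonneg (hA.eigenvalues_nonneg i) p),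
    one_div_mul_cancel hp, Real.rpow_one]

/-- A relative error `δ` of an approximation yields a relative error `2 δ + δ ^ 2` of its square. -/
theorem abs_sq_sub_sq_le_of_abs_sub_le {x y δ : ℝ} (hx : 0 ≤ x) (h : |y - x| ≤ δ * x) :
    |y ^ 2 - x ^ 2| ≤ (2 * δ + δ ^ 2) * x ^ 2 := by
  rw [abs_le] at h ⊢
  constructor <;> nlinarith [h.1, h.2]

theorem mainTheorem3 (n : ℕ) (A : Matrix (Fin n) (Fin n) ℝ) (hA : A.PosDef)
    (a b c d ε p q κ : ℝ) (N : ℕ)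
    (ha : 0 < a) (hac : a ≤ c) (hcd : c < d) (hdb : d ≤ b)
    (hspec : ∀ j, hA.isHermitian.eigenvalues j ∈ Set.Icc c d)
    (hε : 0 < ε) (hε1 : ε ≤ 1) (hp : 1 ≤ p) (hq : q = p / 2) (hκ : κ = Real.sqrt (b / a))
    (hN : (N : ℝ) ≥
      Real.log (4 / ε * (κ ^ 2 + 1) ^ q * (κ - 1) *
          (κ ^ p + Real.sqrt (ε / 2 + κ ^ (2 * p)))) /
        Real.log ((κ + 1) / (κ - 1))) :
    |((Polynomial.aeval A (chebyshevApprox c d (fun x : ℝ => x ^ (p / 2)) N)) ^ 2).trace -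
        schattenNorm p A ^ p| ≤
      ε / 2 * schattenNorm p A ^ p := by
  have hc : 0 < c := ha.trans_le hac
  have hq0 : 0 ≤ q := by rw [hq]; linarith
  have hκ2 : κ ^ 2 = b / a := by
    rw [hκ, Real.sq_sqrt (div_nonneg (by linarith) ha.le)]
  have hκ1 : 1 < κ := by
    rw [hκ, Real.lt_sqrt zero_le_one, one_pow, one_lt_div ha]
    linarith
  have hdκ : d ≤ κ ^ 2 * c := by
    rw [hκ2, div_mul_eq_mul_div, le_div_iff₀ ha]
    nlinarith
  have hκ1' : 0 < κ - 1 := by linarith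
  set ρ := (κ + 1) / (κ - 1) with hρ
  have hρ1 : 1 < ρ := by rw [hρ, one_lt_div hκ1']; linarith
  set B := (κ ^ 2 + 1) ^ q * (κ - 1) with hB
  set S := κ ^ p + Real.sqrt (ε / 2 + κ ^ (2 * p)) with hS
  -- This crude bound is enough to give `δ ≤ ε / 8`.
  have hS2 : 2 ≤ S := by
    have h1 : 1 ≤ κ ^ p := Real.one_le_rpow hκ1.le (by linarith)
    have h2 : 1 ≤ κ ^ (2 * p) := Real.one_le_rpow hκ1.le (by linarith)
    have h3 : 1 ≤ Real.sqrt (ε / 2 + κ ^ (2 * p)) := Real.one_le_sqrt.2 (by linarith)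
    linarith
  have hB0 : 0 < B := by positivity
  have hNρ : 4 / ε * B * S ≤ ρ ^ N := by
    rw [ge_iff_le, div_le_iff₀ (Real.log_pos hρ1), mul_assoc (4 / ε), ← hB, ← Real.log_pow] at hN
    exact (Real.log_le_log_iff (by positivity) (by positivity)).1 hN
  set δ := B * (ρ ^ N)⁻¹ with hδ
  have hδ0 : 0 ≤ δ := by positivity
  have hδε : δ ≤ ε / 8 := by
    rw [hδ, ← div_eq_mul_inv, div_le_iff₀ (by positivity)]
    calc B = ε / 8 * (4 / ε * B * 2) := by field_simp; ring
      _ ≤ ε / 8 * (4 / ε * B * S) := by gcongr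
      _ ≤ _ := by gcongr
  -- Indeed `ε / 4 + ε² / 64 ≤ ε / 2` because `ε ≤ 1`.
  have hδ2 : 2 * δ + δ ^ 2 ≤ ε / 2 := by nlinarith
  rw [hA.posSemidef.schattenNorm_rpow (by linarith), ← map_pow, hA.isHermitian.trace_aeval,
    ← Finset.sum_sub_distrib, Finset.mul_sum, ← hq]
  refine (Finset.abs_sum_le_sum_abs _ _).trans (Finset.sum_le_sum fun i _ => ?_)
  set x := hA.isHermitian.eigenvalues i with hx
  have hxI : x ∈ Set.Icc c d := hspec i
  have hx0 : 0 < x := hc.trans_le hxI.1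
  have hxp : x ^ p = (x ^ q) ^ 2 := by
    rw [← Real.rpow_natCast, ← Real.rpow_mul hx0.le, hq]
    norm_num
  have herr := abs_eval_chebyshevApprox_rpow_sub_le hc hcd hq0 hκ1 hdκ N hxI
  have hrel : |(chebyshevApprox c d (fun x : ℝ => x ^ q) N).eval x - x ^ q| ≤ δ * x ^ q := by
    refine herr.trans ?_
    rw [Real.mul_rpow hc.le (by positivity), ← hρ]
    calc _ = δ * c ^ q := by rw [hδ, hB]; ring
      _ ≤ _ := by gcongr; exact hxI.1
  change |_ - x ^ p| ≤ ε / 2 * x ^ p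
  rw [hxp, Polynomial.eval_pow]
  refine (abs_sq_sub_sq_le_of_abs_sub_le (by positivity) hrel).trans ?_
  gcongr
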